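/- Let $K=\mathbb R$ or $K=\mathbb C$. Points $P_i\in K^3$ are observed by the fixed calibrated camera $[I;0]$ in three images: at $P_i$; at $P_i'=AP_i+a$ after a first deformation $(A,a)$; and at $P_i''=\lambda AP_i'+\mu a$ after a second deformation $(\lambda A,\mu a)$. Here $\det A\ne0$ and $\lambda,\mu\in K\setminus\{0\}$. Write $x\equiv y$ if $y=sx$ for some nonzero scalar $s$; two points have the same image when their coordinate vectors are $\equiv$. Put $C=\lambda A^2$ and $c=\lambda Aa+\mu a$, so that $P_i''=CP_i+c$, and let $E_{12}=[a]_\times A$ and $E_{13}=[c]_\times C$ be the essential matrices. We say that the points determine the essential matrix $[t]_\times M$ of a deformation $(M,t)$ if every rank-2 matrix $E$ with $(MP_i+t)^{T}EP_i=0$ for all $i$ satisfies $E\equiv[t]_\times M$. **Theorem.** There is a nonzero real polynomial $G$ in the $14$ variables $(A,a,\lambda,\mu)$ such that for all $(A,a,\lambda,\mu)$ over $K$ with $\det A\neq0$, $\lambda\ne0$, $\mu\neq 0$ and $G(A,a,\lambda,\mu)\neq0$ the following hold. 1. Let $A_0,C_0\in K^{3\times3}$ and $a_0,c_0\in K^3$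 satisfy $[a_0]_\times A_0\equiv E_{12}$ and $[c_0]_\times C_0\equiv E_{13}$. Then, with $\lambda,\mu$ as parameters, the variety of all $(\alpha,\gamma,x,z,v_1,v_3)\in K^{10}$ with $$\lambda(A_0+a_0v_1^T)a_0+\alpha\mu a_0-\gamma c_0=0,\qquad \lambda\gamma(A_0+a_0v_1^T)^2-\alpha^2(C_0+c_0v_3^T)=0,\qquad \alpha x=\gamma z=1$$ is finite. 2. If moreover $[a_0]_\times A_0=E_{12}$ and $[c_0]_\times C_0=E_{13}$, this variety is a single point, and at this point $a=\alpha a_0$, $A=\frac1\alpha(A_0+a_0v_1^T)$, $c=\gamma c_0$ and $C=\frac1\gamma(C_0+c_0v_3^T)$. Likewise, let a scene with points $\tilde P_i$ and deformations $(\tilde A,\tilde a)$, $(\lambda\tilde A,\mu\tilde a)$, $\det\tilde A\neq0$, have the same three images and exactly the same matrices $E_{12},E_{13}$. Then $\tilde A=A$, $\tilde a=a$ and $\tilde P_i=P_i$ for all $i$. 3. Let $P_1,\dots,P_n$ be points that determine both $E_{12}$ and $E_{13}$. - Given $\lambda,\mu$: up to the global scale change $(\tilde A,\tilde a,\tilde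 P_i)\mapsto(\tilde A,k\tilde a,k\tilde P_i)$, $k\neq0$, only finitely many $(\tilde A,\tilde a,\tilde P_i)$ with $\det\tilde A\ne0$ give the same three images with the deformations $(\tilde A,\tilde a)$ and $(\lambda\tilde A,\mu\tilde a)$. - If $\lambda,\mu$ are unknown: up to the scale changes $$(\tilde A,\tilde a,\tilde\lambda,\tilde\mu,\tilde P_i)\mapsto\Bigl(s\tilde A,\;k\tilde a,\;\tfrac gs\tilde\lambda,\;g\tilde\mu,\;\tfrac ks\tilde P_i\Bigr),\qquad s,k,g\ne0,$$ none of which changes any image, only finitely many $(\tilde A,\tilde a,\tilde\lambda,\tilde\mu,\tilde P_i)$ with $\det\tilde A\neq0$ and $\tilde\lambda,\tilde\mu\neq0$ give the same three images. 4. For every $n\ge8$ there is a nonzero polynomial $H$ in the coordinates of $n$ points such that all $P_1,\dots,P_n\in K^3$ with $H(P_1,\dots,P_n)\neq0$ determine both $E_{12}$ and $E_{13}$. -/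

import Mathlib

namespace NRSfM

/-- The matrix `[t]ₓ` of the cross product `y ↦ t × y` in the standard basis. -/
def crossMatrix {K : Type*} [Field K] (t : Fin 3 → K) : Matrix (Fin 3) (Fin 3) K :=
  !![0, -t 2, t 1; t 2, 0, -t 0; -t 1, t 0, 0]

/-- The essential matrix `[t]ₓ M` of the affine deformation `P ↦ M P + t`, for the calibrated
camera `[I; 0]`. -/
def essentialMatrix {K : Type*} [Field K] (M : Matrix (Fin 3) (Fin 3) K) (t : Fin 3 → K) :
    Matrix (Fin 3) (Fin 3) K :=
  crossMatrix t * M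

/-- Linear part of the deformation from the first to the third image, when `(A, a)` is followed
by `(lam A, mu a)`. -/
def totalLinear {K : Type*} [Field K] (A : Matrix (Fin 3) (Fin 3) K) (lam : K) :
    Matrix (Fin 3) (Fin 3) K :=
  (lam • A) * A

/-- Translation part of the deformation from the first to the third image, when `(A, a)` is
followed by `(lam A, mu a)`. -/
def totalTranslation {K : Type*} [Field K] (A : Matrix (Fin 3) (Fin 3) K) (a : Fin 3 → K)
    (lam mu : K) : Fin 3 → K :=
  (lam • A).mulVec a + mu • a

/-- Equality up to multiplication by a nonzero scalar. -/
def ProjEq {K V : Type*} [Field K] [AddCommGroup V] [Module K V] (x y : V) : Prop :=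
  ∃ s : K, s ≠ 0 ∧ y = s • x

/-- The unknowns of the reconstruction system. The unknowns `x` and `z` are the inverses of
`α` and `γ`. -/
structure Unknowns (K : Type*) where
  (α γ x z : K)
  (v₁ v₃ : Fin 3 → K)

/-- The affine variety in ten-dimensional space cut out by the reconstruction system of a
quasi-identical pair of deformations, where `[a₀]ₓ A₀` and `[c₀]ₓ C₀` are factorizations of the
essential matrices of the image pairs `(1, 2)` and `(1, 3)`; `lam` and `mu` are parameters. -/
def systemVariety {K : Type*} [Field K] (A₀ : Matrix (Fin 3) (Fin 3) K) (a₀ : Fin 3 → K)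
    (C₀ : Matrix (Fin 3) (Fin 3) K) (c₀ : Fin 3 → K) (lam mu : K) : Set (Unknowns K) :=
  {p | lam • (A₀ + Matrix.vecMulVec a₀ p.v₁).mulVec a₀ + (p.α * mu) • a₀ - p.γ • c₀ = 0 ∧
    (lam * p.γ) • (A₀ + Matrix.vecMulVec a₀ p.v₁) ^ 2
      - p.α ^ 2 • (C₀ + Matrix.vecMulVec c₀ p.v₃) = 0 ∧
    p.α * p.x - 1 = 0 ∧ p.γ * p.z - 1 = 0}

/-- The points `P i`, together with a first deformation `(A, a)` and a second deformation
`(lam A, mu a)`. -/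
structure Scene (K : Type*) (n : ℕ) where
  A : Matrix (Fin 3) (Fin 3) K
  a : Fin 3 → K
  lam : K
  mu : K
  P : Fin n → Fin 3 → K

namespace Scene

variable {K : Type*} [Field K] {n : ℕ}

/-- The deformations are invertible and the two scalars are nonzero. -/
def Valid (R : Scene K n) : Prop :=
  R.A.det ≠ 0 ∧ R.lam ≠ 0 ∧ R.mu ≠ 0

/-- The points after the first deformation. -/
def second (R : Scene K n) (i : Fin n) : Fin 3 → K :=
  R.A.mulVec (R.P i) + R.a

/-- The points after the second deformation. -/
def third (R : Scene K n) (i : Fin n) : Fin 3 → K :=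
  (R.lam • R.A).mulVec (R.second i) + R.mu • R.a

/-- The two scenes have the same three images. With the camera `[I; 0]`, the homogeneous
coordinates of the image of a point are its affine coordinates. -/
def SameImages (R R' : Scene K n) : Prop :=
  ∀ i, ProjEq (K := K) (R.P i) (R'.P i) ∧ ProjEq (K := K) (R.second i) (R'.second i) ∧
    ProjEq (K := K) (R.third i) (R'.third i)

/-- The scene obtained by rescaling the points by `k / s`, `k` and `g * k` in the first, second
and third positions. The second deformation `(lam A, mu a)` becomes `(g lam A, g k mu a)`. -/
def rescale (R : Scene K n) (s k g : K) : Scene K n where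
  A := s • R.A
  a := k • R.a
  lam := (g / s) * R.lam
  mu := g * R.mu
  P := fun i => (k / s) • R.P i

end Scene

/-- The correspondences between `P i` and `M (P i) + t` determine the essential matrix up to a
scalar: the configuration is not critical for the deformation `(M, t)`. -/
def DeterminesEssential {K : Type*} [Field K] {n : ℕ} (M : Matrix (Fin 3) (Fin 3) K)
    (t : Fin 3 → K) (P : Fin n → Fin 3 → K) : Prop :=
  ∀ E : Matrix (Fin 3) (Fin 3) K, E.rank = 2 →
    (∀ i, (M.mulVec (P i) + t) ⬝ᵥ E.mulVec (P i) = 0) →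
    ProjEq (K := K) (essentialMatrix M t) E

/-- Coordinates on the space of quasi-identical pairs: the nine entries of `A`, the three entries
of `a`, and the two scalars. -/
abbrev DataIndex : Type := (Fin 3 × Fin 3) ⊕ (Fin 3 ⊕ Fin 2)

/-- The coordinates of a quasi-identical pair. -/
def dataPoint {K : Type*} [Field K] (A : Matrix (Fin 3) (Fin 3) K) (a : Fin 3 → K)
    (lam mu : K) : DataIndex → K :=
  Sum.elim (fun ij => A ij.1 ij.2) (Sum.elim a ![lam, mu])

end NRSfM

namespace NRSfM

open Matrix

/-! ### Factorizations of essential matrices and the vectors that measure their ambiguity. -/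

section Field

variable {K : Type*} [Field K]

/-! An essential matrix fixes its translation up to scale and its linear part up to scale and a term
`t wᵀ`. Hence a competing quasi-identical pair has `a' = k a`, `A' = σ (A + a vᵀ)`. The pair (1,3)
gives `c' = k' c`, `C' = σ' C + c uᵀ`. Both `c` and `C` are built from `A`, `a`; comparing
coefficients along `A a` and `a` eliminates `u` and leaves `λ (vᵀA + (v·a) vᵀ) = μ vᵀ`
(`exists_mem_ambiguitySet`): `v` is zero or a left eigenvector of `A` with eigenvalue `μ/λ - v·a`.

Suppose `a, A a, A² a` are independent. Two solutions `v` with the same eigenvalue differ by a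
vector `d` with `d·a = 0` and `dᵀA = θ dᵀ`, so `d` is orthogonal to all three and vanishes. There is
thus at most one nonzero solution per eigenvalue, and the ambiguity is finite
(`ambiguitySet_finite`). If the essential matrices are known exactly, the scales agree up to sign,
so a nonzero `v` would make `μ` or `-μ` an eigenvalue of `λ A`. Accordingly `G` is the Krylov
determinant times `det(λA - μI) det(λA + μI)`.

Once the deformations are known, the images fix the points (`SameImages.eq_of_deformations_eq`).
Eight general points suffice because only multiples of the essential matrix satisfy the epipolar
equation at every point (`exists_eq_smul_essentialMatrix`). -/

theorem crossMatrix_smul (k : K) (t : Fin 3 → K) : crossMatrix (k • t) = k • crossMatrix t := by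
  ext i j; fin_cases i <;> fin_cases j <;> simp [crossMatrix]

theorem crossMatrix_mulVec_self (t : Fin 3 → K) : crossMatrix t *ᵥ t = 0 := by
  ext i; fin_cases i <;> simp [crossMatrix, mulVec, dotProduct, Fin.sum_univ_three] <;> ring

theorem vecMul_crossMatrix (t u : Fin 3 → K) : u ᵥ* crossMatrix t = -(crossMatrix t *ᵥ u) := by
  ext i
  fin_cases i <;> simp [crossMatrix, vecMul, dotProduct, Fin.sum_univ_three] <;> ring

theorem dotProduct_crossMatrix_mulVec_self (t u : Fin 3 → K) :
    u ⬝ᵥ crossMatrix t *ᵥ u = 0 := by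
  simp [crossMatrix, mulVec, dotProduct, Fin.sum_univ_three]; ring

theorem exists_smul_eq_of_crossMatrix_mulVec_eq_zero {t w : Fin 3 → K} (ht : t ≠ 0)
    (h : crossMatrix t *ᵥ w = 0) : ∃ k : K, w = k • t := by
  have h0 := congrFun h 0
  have h1 := congrFun h 1
  have h2 := congrFun h 2
  simp [crossMatrix, mulVec, dotProduct, Fin.sum_univ_three] at h0 h1 h2
  obtain ⟨j, hj⟩ := Function.ne_iff.1 ht
  refine ⟨w j / t j, ?_⟩
  simp only [Pi.zero_apply] at hj
  ext i
  simp only [Pi.smul_apply, smul_eq_mul]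
  field_simp
  fin_cases i <;> fin_cases j <;> simp only [Fin.zero_eta, Fin.mk_one, Fin.reduceFinMk] <;> first
    | ring1
    | linear_combination h0
    | linear_combination -h0
    | linear_combination h1
    | linear_combination -h1
    | linear_combination h2
    | linear_combination -h2

theorem mulVec_vecMulVec_mulVec (a v x : Fin 3 → K) : vecMulVec a v *ᵥ x = (v ⬝ᵥ x) • a := by
  ext i; simp [vecMulVec_apply, mulVec, dotProduct, Fin.sum_univ_three]; ring

theorem exists_eq_vecMulVec_of_crossMatrix_mul_eq_zero {t : Fin 3 → K} (ht : t ≠ 0)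
    {M : Matrix (Fin 3) (Fin 3) K} (h : crossMatrix t * M = 0) :
    ∃ w : Fin 3 → K, M = vecMulVec t w := by
  have hc : ∀ j, ∃ k : K, M.col j = k • t := fun j => by
    refine exists_smul_eq_of_crossMatrix_mulVec_eq_zero ht ?_
    ext i
    exact congrFun (congrFun h i) j
  choose w hw using hc
  refine ⟨w, ?_⟩
  ext i j
  have := congrFun (hw j) i
  simp only [col_apply, Pi.smul_apply, smul_eq_mul] at this
  rw [vecMulVec_apply, this, mul_comm]

theorem crossMatrix_mul_vecMulVec (t w : Fin 3 → K) : crossMatrix t * vecMulVec t w = 0 := by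
  rw [mul_vecMulVec, crossMatrix_mulVec_self, zero_vecMulVec]

theorem crossMatrix_ne_zero {t : Fin 3 → K} (ht : t ≠ 0) : crossMatrix t ≠ 0 := by
  intro h
  apply ht
  have h0 := congrFun (congrFun h 2) 1
  have h1 := congrFun (congrFun h 0) 2
  have h2 := congrFun (congrFun h 1) 0
  simp [crossMatrix] at h0 h1 h2
  ext i; fin_cases i <;> simp [h0, h1, h2]

theorem essentialMatrix_ne_zero {M : Matrix (Fin 3) (Fin 3) K} {t : Fin 3 → K} (hM : M.det ≠ 0)
    (ht : t ≠ 0) : essentialMatrix M t ≠ 0 := by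
  intro h
  apply crossMatrix_ne_zero ht
  have := congrArg (· * M⁻¹) h
  simpa [essentialMatrix, Matrix.mul_assoc, mul_nonsing_inv M (isUnit_iff_ne_zero.2 hM)] using this

/-- Two factorizations of an essential matrix have proportional translations, and linear parts
that agree up to scale and a rank-one term along the translation. -/
theorem exists_of_essentialMatrix_eq_smul {M N : Matrix (Fin 3) (Fin 3) K} {t u : Fin 3 → K}
    {s : K} (hM : M.det ≠ 0) (ht : t ≠ 0) (hs : s ≠ 0)
    (h : essentialMatrix N u = s • essentialMatrix M t) :
    ∃ (k : K) (w : Fin 3 → K), k ≠ 0 ∧ u = k • t ∧ N = (s / k) • M + vecMulVec t w := by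
  -- Multiplying by `uᵀ` on the left kills `[u]ₓ N`, so `uᵀ [t]ₓ M = 0` and `M` can be cancelled.
  have hu : crossMatrix t *ᵥ u = 0 := by
    have h1 := congrArg (fun X => u ᵥ* X) h
    simp only [essentialMatrix, vecMul_smul, ← vecMul_vecMul, vecMul_crossMatrix,
      crossMatrix_mulVec_self, neg_zero, zero_vecMul] at h1
    have h2 := (smul_eq_zero.1 h1.symm).resolve_left hs
    exact neg_eq_zero.1 (eq_zero_of_vecMul_eq_zero hM h2)
  obtain ⟨k, rfl⟩ := exists_smul_eq_of_crossMatrix_mulVec_eq_zero ht hu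
  have hk : k ≠ 0 := by
    rintro rfl
    have : s • essentialMatrix M t = 0 := by
      rw [← h, essentialMatrix, crossMatrix_smul, zero_smul, zero_mul]
    exact essentialMatrix_ne_zero hM ht ((smul_eq_zero.1 this).resolve_left hs)
  have h3 : crossMatrix t * (N - (s / k) • M) = 0 := by
    have : k • (crossMatrix t * (N - (s / k) • M)) = 0 := by
      simp only [essentialMatrix, crossMatrix_smul, smul_mul] at h
      rw [mul_sub, smul_sub, h, Matrix.mul_smul, smul_smul, mul_div_cancel₀ _ hk, sub_self]
    exact (smul_eq_zero.1 this).resolve_left hk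
  obtain ⟨w, hw⟩ := exists_eq_vecMulVec_of_crossMatrix_mul_eq_zero ht h3
  exact ⟨k, w, hk, rfl, by rw [← hw]; abel⟩

theorem rank_crossMatrix {t : Fin 3 → K} (ht : t ≠ 0) : (crossMatrix t).rank = 2 := by
  have hker : LinearMap.ker (crossMatrix t).mulVecLin = Submodule.span K {t} := by
    ext w
    rw [LinearMap.mem_ker, mulVecLin_apply, Submodule.mem_span_singleton]
    constructor
    · intro h
      obtain ⟨k, hk⟩ := exists_smul_eq_of_crossMatrix_mulVec_eq_zero ht h
      exact ⟨k, hk.symm⟩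
    · rintro ⟨k, rfl⟩
      rw [mulVec_smul, crossMatrix_mulVec_self, smul_zero]
  have := LinearMap.finrank_range_add_finrank_ker (crossMatrix t).mulVecLin
  rw [hker, finrank_span_singleton ht, Module.finrank_fin_fun] at this
  rw [Matrix.rank]
  omega

theorem rank_essentialMatrix {M : Matrix (Fin 3) (Fin 3) K} {t : Fin 3 → K} (hM : M.det ≠ 0)
    (ht : t ≠ 0) : (essentialMatrix M t).rank = 2 := by
  rw [essentialMatrix, rank_mul_eq_left_of_isUnit_det _ _ (isUnit_iff_ne_zero.2 hM),
    rank_crossMatrix ht]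

/-- The determinant of the Krylov matrix with rows `a`, `A a`, `A² a`. -/
def krylovDet {R : Type*} [CommRing R] (A : Matrix (Fin 3) (Fin 3) R) (a : Fin 3 → R) : R :=
  (Matrix.of ![a, A *ᵥ a, A *ᵥ (A *ᵥ a)]).det

/-- A left eigenvector orthogonal to `a` is orthogonal to every `Aⁱ a`, and these span the space. -/
theorem eq_zero_of_krylovDet_ne_zero {A : Matrix (Fin 3) (Fin 3) K} {a d : Fin 3 → K} {θ : K}
    (hA : krylovDet A a ≠ 0) (hd : d ᵥ* A = θ • d) (hda : d ⬝ᵥ a = 0) : d = 0 := by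
  have h1 : d ⬝ᵥ A *ᵥ a = 0 := by
    rw [dotProduct_mulVec, hd, smul_dotProduct, hda, smul_zero]
  have h2 : d ⬝ᵥ A *ᵥ (A *ᵥ a) = 0 := by
    rw [dotProduct_mulVec, hd, smul_dotProduct, h1, smul_zero]
  refine eq_zero_of_mulVec_eq_zero hA ?_
  ext i
  fin_cases i
  · exact (dotProduct_comm _ _).trans hda
  · exact (dotProduct_comm _ _).trans h1
  · exact (dotProduct_comm _ _).trans h2

theorem eq_zero_of_smul_add_smul_eq_zero {A : Matrix (Fin 3) (Fin 3) K} {a : Fin 3 → K}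
    (hA : krylovDet A a ≠ 0) {x y : K} (h : x • A *ᵥ a + y • a = 0) : x = 0 ∧ y = 0 := by
  have : ![y, x, 0] = 0 := by
    refine eq_zero_of_vecMul_eq_zero hA ?_
    ext j
    have := congrFun h j
    simp [vecMul, dotProduct, Fin.sum_univ_three] at this ⊢
    linear_combination this
  exact ⟨by simpa using congrFun this 1, by simpa using congrFun this 0⟩

theorem ne_zero_of_krylovDet_ne_zero {A : Matrix (Fin 3) (Fin 3) K} {a : Fin 3 → K}
    (hA : krylovDet A a ≠ 0) : a ≠ 0 := by
  rintro rfl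
  exact one_ne_zero (eq_zero_of_smul_add_smul_eq_zero hA (x := 0) (y := 1) (by simp)).2

theorem totalTranslation_eq (A : Matrix (Fin 3) (Fin 3) K) (a : Fin 3 → K) (lam mu : K) :
    totalTranslation A a lam mu = lam • A *ᵥ a + mu • a := by
  rw [totalTranslation, smul_mulVec]

theorem totalTranslation_ne_zero {A : Matrix (Fin 3) (Fin 3) K} {a : Fin 3 → K} {lam mu : K}
    (hA : krylovDet A a ≠ 0) (hl : lam ≠ 0) : totalTranslation A a lam mu ≠ 0 := by
  rw [totalTranslation_eq]
  exact fun h => hl (eq_zero_of_smul_add_smul_eq_zero hA h).1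

theorem det_totalLinear_ne_zero {A : Matrix (Fin 3) (Fin 3) K} {lam : K}
    (hA : A.det ≠ 0) (hl : lam ≠ 0) : (totalLinear A lam).det ≠ 0 := by
  rw [totalLinear, det_mul, det_smul]
  exact mul_ne_zero (mul_ne_zero (pow_ne_zero _ hl) hA) hA

/-- The vectors `v` such that `A + a vᵀ` is, up to scale, the linear part of a quasi-identical
pair with the same essential matrices as `(A, a, lam, mu)`. -/
def ambiguitySet (A : Matrix (Fin 3) (Fin 3) K) (a : Fin 3 → K) (lam mu : K) :
    Set (Fin 3 → K) :=
  {v | lam • (v ᵥ* A + (v ⬝ᵥ a) • v) = mu • v}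

theorem vecMul_eq_of_mem_ambiguitySet {A : Matrix (Fin 3) (Fin 3) K} {a : Fin 3 → K}
    {lam mu : K} (hl : lam ≠ 0) {v : Fin 3 → K} (hv : v ∈ ambiguitySet A a lam mu) :
    v ᵥ* A = (mu / lam - v ⬝ᵥ a) • v := by
  have h : v ᵥ* A + (v ⬝ᵥ a) • v = (mu / lam) • v := by
    rw [div_eq_inv_mul, mul_smul, ← hv.out, inv_smul_smul₀ hl]
  rw [sub_smul, ← h]; abel

/-- The map `v ↦ mu / lam - v ⬝ᵥ a` sends nonzero solutions to roots of the characteristic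
polynomial. It is injective on them, since two solutions with equal value differ by a left
eigenvector orthogonal to `a`. -/
theorem ambiguitySet_finite {A : Matrix (Fin 3) (Fin 3) K} {a : Fin 3 → K} {lam mu : K}
    (hA : krylovDet A a ≠ 0) (hl : lam ≠ 0) : (ambiguitySet A a lam mu).Finite := by
  classical
  have key : (ambiguitySet A a lam mu \ {0}).Finite := by
    refine Set.Finite.of_finite_image (f := fun v => mu / lam - v ⬝ᵥ a)
      ((A.charpoly.roots.toFinset.finite_toSet).subset ?_) ?_
    · rintro _ ⟨v, ⟨hv, hv0⟩, rfl⟩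
      have h := vecMul_eq_of_mem_ambiguitySet hl hv
      simp only [Finset.mem_coe, Multiset.mem_toFinset]
      rw [Polynomial.mem_roots A.charpoly_monic.ne_zero, Polynomial.IsRoot, eval_charpoly]
      by_contra hdet
      refine hv0 (eq_zero_of_vecMul_eq_zero hdet ?_)
      rw [vecMul_sub, h, scalar_apply, vecMul_diagonal_const, op_smul_eq_smul, sub_self]
    · rintro v ⟨hv, -⟩ w ⟨hw, -⟩ hvw
      have h1 := vecMul_eq_of_mem_ambiguitySet hl hv
      have h2 := vecMul_eq_of_mem_ambiguitySet hl hw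
      simp only at hvw
      rw [← hvw] at h2
      refine sub_eq_zero.1 (eq_zero_of_krylovDet_ne_zero hA (θ := mu / lam - v ⬝ᵥ a) ?_ ?_)
      · rw [sub_vecMul, h1, h2, smul_sub]
      · rw [sub_dotProduct, sub_eq_zero]; exact sub_right_injective hvw
  exact (key.insert 0).subset fun v hv => by
    by_cases h : v = 0
    · exact Or.inl h
    · exact Or.inr ⟨hv, h⟩

/-- The rank is at most two. This forces the coefficient of the invertible `A²` to vanish when the
two total linear parts are compared. -/
theorem det_vecMulVec_add_vecMulVec (b p a q : Fin 3 → K) :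
    (vecMulVec b p + vecMulVec a q).det = 0 := by
  simp [det_fin_three, vecMulVec_apply]; ring

theorem eq_zero_of_vecMulVec_add_vecMulVec_eq_zero {A : Matrix (Fin 3) (Fin 3) K}
    {a p q : Fin 3 → K} (hA : krylovDet A a ≠ 0)
    (h : vecMulVec (A *ᵥ a) p + vecMulVec a q = 0) : p = 0 ∧ q = 0 := by
  have : ∀ j, p j = 0 ∧ q j = 0 := fun j => by
    refine eq_zero_of_smul_add_smul_eq_zero hA ?_
    ext i
    have := congrFun (congrFun h i) j
    simp [vecMulVec_apply] at this ⊢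
    linear_combination this
  exact ⟨funext fun j => (this j).1, funext fun j => (this j).2⟩

theorem add_vecMulVec_mul_self (A : Matrix (Fin 3) (Fin 3) K) (a v : Fin 3 → K) :
    (A + vecMulVec a v) * (A + vecMulVec a v) =
      A * A + vecMulVec (A *ᵥ a) v + vecMulVec a (v ᵥ* A + (v ⬝ᵥ a) • v) := by
  rw [add_mul, mul_add, mul_add, mul_vecMulVec, vecMulVec_mul, vecMulVec_mul_vecMulVec,
    vecMulVec_add]

/-- Two quasi-identical pairs with proportional essential matrices differ by scales and by a
vector of the ambiguity set. -/
theorem exists_mem_ambiguitySet {A A' : Matrix (Fin 3) (Fin 3) K} {a a' : Fin 3 → K}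
    {lam mu lam' mu' s s' : K} (hA : krylovDet A a ≠ 0) (hdet : A.det ≠ 0) (hl : lam ≠ 0)
    (hl' : lam' ≠ 0) (hs : s ≠ 0) (hs' : s' ≠ 0)
    (h12 : essentialMatrix A' a' = s • essentialMatrix A a)
    (h13 : essentialMatrix (totalLinear A' lam') (totalTranslation A' a' lam' mu') =
      s' • essentialMatrix (totalLinear A lam) (totalTranslation A a lam mu)) :
    ∃ (σ k : K), ∃ v ∈ ambiguitySet A a lam mu, σ ≠ 0 ∧ k ≠ 0 ∧ a' = k • a ∧
      A' = σ • (A + vecMulVec a v) ∧ mu' * lam = lam' * σ * (mu - lam * (v ⬝ᵥ a)) ∧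
      s = k * σ ∧ s' * lam ^ 2 = lam' ^ 2 * k * σ ^ 3 := by
  have ha := ne_zero_of_krylovDet_ne_zero hA
  obtain ⟨k, w, hk, rfl, hA'⟩ := exists_of_essentialMatrix_eq_smul hdet ha hs h12
  obtain ⟨k', u, hk', hc, hC⟩ := exists_of_essentialMatrix_eq_smul
    (det_totalLinear_ne_zero hdet hl) (totalTranslation_ne_zero hA hl) hs' h13
  obtain ⟨σ, hσ⟩ : ∃ σ, σ = s / k := ⟨_, rfl⟩
  obtain ⟨σ', hσ'⟩ : ∃ σ', σ' = s' / k' := ⟨_, rfl⟩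
  have hσ0 : σ ≠ 0 := hσ ▸ div_ne_zero hs hk
  have hsk : s = k * σ := by rw [hσ]; field_simp
  have hsk' : s' = k' * σ' := by rw [hσ']; field_simp
  rw [← hσ'] at hC
  obtain ⟨v, hv⟩ : ∃ v, v = σ⁻¹ • w := ⟨_, rfl⟩
  have hA2 : A' = σ • (A + vecMulVec a v) := by
    rw [hA', hv, vecMulVec_smul, smul_add, smul_inv_smul₀ hσ0, hσ]
  clear hA' hv hσ hσ'
  subst hA2
  -- The relation `c' = k' c`, sorted along `A a` and `a`.
  have hvec : (lam' * k * σ - k' * lam) • A *ᵥ a +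
      (lam' * k * σ * (v ⬝ᵥ a) + mu' * k - k' * mu) • a = 0 := by
    rw [totalTranslation_eq, totalTranslation_eq, mulVec_smul, smul_mulVec, add_mulVec,
      mulVec_vecMulVec_mulVec] at hc
    ext i
    have := congrFun hc i
    simp only [Pi.add_apply, Pi.smul_apply, smul_eq_mul, Pi.zero_apply] at this ⊢
    linear_combination this
  obtain ⟨e1, e2⟩ := eq_zero_of_smul_add_smul_eq_zero hA hvec
  -- The relation `C' = σ' C + c uᵀ`, with the multiples of `A²` on one side and the rank-one terms
  -- along `A a` and `a` on the other.
  have hmat : (lam' * σ ^ 2 - σ' * lam) • (A * A) =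
      vecMulVec (A *ᵥ a) (lam • u - (lam' * σ ^ 2) • v) +
      vecMulVec a (mu • u - (lam' * σ ^ 2) • (v ᵥ* A + (v ⬝ᵥ a) • v)) := by
    rw [totalLinear, totalLinear, totalTranslation_eq, smul_mul, smul_mul, smul_mul, Matrix.mul_smul,
      add_vecMulVec_mul_self] at hC
    ext i j
    have := congrFun (congrFun hC i) j
    simp only [Matrix.add_apply, Matrix.smul_apply, vecMulVec_apply, Pi.add_apply, Pi.sub_apply,
      Pi.smul_apply, smul_eq_mul] at this ⊢
    linear_combination this
  have e3 : lam' * σ ^ 2 - σ' * lam = 0 := by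
    have := congrArg Matrix.det hmat
    rw [det_vecMulVec_add_vecMulVec, det_smul, det_mul] at this
    simpa [hdet] using this
  rw [e3, zero_smul] at hmat
  obtain ⟨e4, e5⟩ := eq_zero_of_vecMulVec_add_vecMulVec_eq_zero hA hmat.symm
  refine ⟨σ, k, v, ?_, hσ0, hk, rfl, rfl, ?_, hsk, ?_⟩
  -- Eliminating `u` between the two vector equations gives the eigenvector condition.
  · have hne : lam' * σ ^ 2 ≠ 0 := mul_ne_zero hl' (pow_ne_zero _ hσ0)
    refine smul_right_injective _ hne ?_
    ext i
    have h4 := congrFun e4 i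
    have h5 := congrFun e5 i
    simp only [Pi.add_apply, Pi.sub_apply, Pi.smul_apply, smul_eq_mul, Pi.zero_apply] at h4 h5 ⊢
    linear_combination mu * h4 - lam * h5
  · refine mul_left_cancel₀ hk ?_
    linear_combination lam * e2 - mu * e1
  · rw [hsk']
    linear_combination -lam' * σ ^ 2 * e1 - k' * lam * e3

end Field

/-! ### Eight general points determine the essential matrix. -/

section Generic

variable {K : Type*} [Field K]

/-- If the vectors `f x` and `u` have no common nonzero orthogonal vector, then `u` can be
completed by values of `f` to an independent family of any length up to the dimension. -/
theorem exists_linearIndependent_cons {X ι : Type*} [Fintype ι] (f : X → ι → K) {u : ι → K}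
    (hu : u ≠ 0) (h : ∀ E, u ⬝ᵥ E = 0 → (∀ x, f x ⬝ᵥ E = 0) → E = 0) (m : ℕ)
    (hm : m + 1 ≤ Fintype.card ι) :
    ∃ x : Fin m → X,
      LinearIndependent K (Fin.cons u (fun i => f (x i)) : Fin (m + 1) → ι → K) := by
  induction m with
  | zero =>
    refine ⟨Fin.elim0, ?_⟩
    rw [linearIndependent_finCons, Set.range_eq_empty, Submodule.span_empty, Submodule.mem_bot]
    exact ⟨linearIndependent_empty_type, hu⟩
  | succ m ih =>
    obtain ⟨x, hx⟩ := ih (by omega)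
    obtain ⟨W, hW⟩ : ∃ W : Fin (m + 1) → ι → K, W = Fin.cons u (fun i => f (x i)) := ⟨_, rfl⟩
    -- Too few vectors to span, so some `E ≠ 0` is orthogonal to all of them; a value of `f` not
    -- orthogonal to `E` lies outside their span.
    have hker : LinearMap.ker (Matrix.of W).mulVecLin ≠ ⊥ :=
      LinearMap.ker_ne_bot_of_finrank_lt (by simpa using hm)
    obtain ⟨E, hE, hE0⟩ := Submodule.exists_mem_ne_zero_of_ne_bot hker
    rw [LinearMap.mem_ker, mulVecLin_apply] at hE
    have hWE : ∀ i, W i ⬝ᵥ E = 0 := fun i => congrFun hE i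
    have huE : u ⬝ᵥ E = 0 := by simpa [hW] using hWE 0
    obtain ⟨p, hp⟩ : ∃ p, f p ⬝ᵥ E ≠ 0 := by
      by_contra! hall
      exact hE0 (h E huE hall)
    refine ⟨Fin.snoc x p, ?_⟩
    have hsnoc : (Fin.cons u (fun i => f ((Fin.snoc x p : Fin (m + 1) → X) i)) :
        Fin (m + 1 + 1) → ι → K) = Fin.snoc W (f p) := by
      rw [hW, ← Fin.cons_snoc_eq_snoc_cons]
      congr 1
      exact Fin.comp_snoc f x p
    rw [hsnoc, linearIndependent_finSnoc]
    refine ⟨hW ▸ hx, fun hmem => hp ?_⟩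
    refine Submodule.span_induction (p := fun w _ => w ⬝ᵥ E = 0) ?_ (zero_dotProduct E) ?_ ?_ hmem
    · rintro _ ⟨i, rfl⟩
      exact hWE i
    · intro v w _ _ hv hw
      rw [add_dotProduct, hv, hw, add_zero]
    · intro c v _ hv
      rw [smul_dotProduct, hv, smul_zero]

/-- The matrix form of `det(Mx, Mp, My) = det M · det(x, p, y)`. -/
theorem transpose_mul_crossMatrix_mul (M : Matrix (Fin 3) (Fin 3) K) (p : Fin 3 → K) :
    Mᵀ * (crossMatrix (M *ᵥ p) * M) = M.det • crossMatrix p := by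
  ext i j
  fin_cases i <;> fin_cases j <;>
    simp [crossMatrix, mul_apply, mulVec, vecMul, dotProduct, Fin.sum_univ_three,
      det_fin_three] <;> ring

/-- A form `(M P + t)ᵀ E P` that vanishes identically comes from a multiple of the essential
matrix. -/
theorem exists_eq_smul_essentialMatrix [CharZero K] {M E : Matrix (Fin 3) (Fin 3) K}
    {t : Fin 3 → K} (hM : M.det ≠ 0) (ht : t ≠ 0)
    (h : ∀ P, (M *ᵥ P + t) ⬝ᵥ E *ᵥ P = 0) : ∃ r : K, E = r • essentialMatrix M t := by
  -- Replacing `P` by `-P` separates the linear part of the form from the quadratic part.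
  have hlin : ∀ P, t ⬝ᵥ E *ᵥ P = 0 := fun P => by
    have h1 := h P
    have h2 := h (-P)
    simp only [add_dotProduct, mulVec_neg, dotProduct_neg, neg_dotProduct] at h1 h2
    have : (2 : K) * (t ⬝ᵥ E *ᵥ P) = 0 := by linear_combination h1 - h2
    simpa using this
  have hquad : ∀ P, P ⬝ᵥ (Mᵀ * E) *ᵥ P = 0 := fun P => by
    have h1 := h P
    rw [add_dotProduct, hlin, add_zero] at h1
    rw [← mulVec_mulVec, dotProduct_mulVec, vecMul_transpose, h1]
  obtain ⟨N, hN⟩ : ∃ N, N = Mᵀ * E := ⟨_, rfl⟩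
  rw [← hN] at hquad
  -- A matrix whose quadratic form vanishes is alternating, hence a cross-product matrix in
  -- dimension three.
  obtain ⟨w, hw⟩ : ∃ w, N = crossMatrix w := by
    refine ⟨![N 2 1, N 0 2, N 1 0], ?_⟩
    have q0 := hquad ![1, 0, 0]
    have q1 := hquad ![0, 1, 0]
    have q2 := hquad ![0, 0, 1]
    have q3 := hquad ![1, 1, 0]
    have q4 := hquad ![1, 0, 1]
    have q5 := hquad ![0, 1, 1]
    simp [mulVec, dotProduct, Fin.sum_univ_three] at q0 q1 q2 q3 q4 q5
    ext i j
    fin_cases i <;> fin_cases j <;> simp [crossMatrix]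
    · exact q0
    · linear_combination q3 - q0 - q1
    · exact q1
    · linear_combination q5 - q1 - q2
    · linear_combination q4 - q0 - q2
    · exact q2
  have hU := isUnit_iff_ne_zero.2 hM
  obtain ⟨p, hp⟩ : ∃ p, t = M *ᵥ p := ⟨M⁻¹ *ᵥ t, by rw [mulVec_mulVec, mul_nonsing_inv M hU, one_mulVec]⟩
  subst hp
  have hp0 : p ≠ 0 := by
    rintro rfl
    exact ht (mulVec_zero M)
  -- The linear part says `tᵀE = 0`, that is `pᵀN = 0`, so `w` is parallel to `p`.
  have hwp : crossMatrix p *ᵥ w = 0 := by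
    have h1 : (M *ᵥ p) ᵥ* E = 0 := by
      ext j
      have := hlin (Pi.single j 1)
      rw [mulVec_single_one] at this
      exact this
    rw [← vecMul_transpose, vecMul_vecMul, ← hN, hw, vecMul_crossMatrix, neg_eq_zero] at h1
    rw [← neg_eq_zero, ← vecMul_crossMatrix]
    ext i
    have := congrFun h1 i
    revert this
    fin_cases i <;> simp [crossMatrix, mulVec, vecMul, dotProduct, Fin.sum_univ_three] <;> intro h <;>
      linear_combination h
  obtain ⟨k, rfl⟩ := exists_smul_eq_of_crossMatrix_mulVec_eq_zero hp0 hwp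
  refine ⟨k / M.det, ?_⟩
  have hMT : IsUnit Mᵀ := by rw [isUnit_iff_isUnit_det, det_transpose]; exact hU
  refine hMT.mul_left_cancel ?_
  rw [← hN, hw, Matrix.mul_smul, essentialMatrix, transpose_mul_crossMatrix_mul, smul_smul,
    div_mul_cancel₀ _ hM, crossMatrix_smul]

/-- The coefficients of the equation `(M P + t)ᵀ E P = 0` in the entries of `E`. -/
def epipolarRow {R : Type*} [CommRing R] (M : Matrix (Fin 3) (Fin 3) R) (t P : Fin 3 → R)
    (j : Fin 3 × Fin 3) : R :=
  (M *ᵥ P + t) j.1 * P j.2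

theorem epipolarRow_dotProduct (M E : Matrix (Fin 3) (Fin 3) K) (t P : Fin 3 → K) :
    (fun j => epipolarRow M t P (finProdFinEquiv.symm j)) ⬝ᵥ
      (fun j : Fin (3 * 3) => E (finProdFinEquiv.symm j).1 (finProdFinEquiv.symm j).2) =
      (M *ᵥ P + t) ⬝ᵥ E *ᵥ P := by
  rw [dotProduct, finProdFinEquiv.symm.sum_comp (fun j => epipolarRow M t P j * E j.1 j.2),
    Fintype.sum_prod_type]
  simp only [dotProduct, mulVec, epipolarRow, Finset.mul_sum]
  exact Finset.sum_congr rfl fun i _ => Finset.sum_congr rfl fun j _ => by ring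

theorem map_epipolarRow {R S : Type*} [CommRing R] [CommRing S] (f : R →+* S)
    (M : Matrix (Fin 3) (Fin 3) R) (t P : Fin 3 → R) (j : Fin 3 × Fin 3) :
    f (epipolarRow M t P j) = epipolarRow (M.map f) (f ∘ t) (f ∘ P) j := by
  simp [epipolarRow, mulVec, dotProduct]

/-- Eight general points determine an essential matrix. -/
theorem exists_forall_determinesEssential [CharZero K] {M : Matrix (Fin 3) (Fin 3) K}
    {t : Fin 3 → K} (hM : M.det ≠ 0) (ht : t ≠ 0) {n : ℕ} (hn : 8 ≤ n) :
    ∃ H : MvPolynomial (Fin n × Fin 3) K, H ≠ 0 ∧ ∀ P : Fin n → Fin 3 → K,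
      MvPolynomial.eval (fun ij => P ij.1 ij.2) H ≠ 0 → DeterminesEssential M t P := by
  obtain ⟨i₀, hi₀⟩ := Function.ne_iff.1 (essentialMatrix_ne_zero hM ht)
  obtain ⟨j₀, hj₀⟩ := Function.ne_iff.1 hi₀
  replace hj₀ : essentialMatrix M t i₀ j₀ ≠ 0 := hj₀
  let e : Fin 3 × Fin 3 ≃ Fin 9 := finProdFinEquiv
  let vec : Matrix (Fin 3) (Fin 3) K → Fin 9 → K := fun E j => E (e.symm j).1 (e.symm j).2
  -- The ninth row reads an entry where the essential matrix is nonzero. Together with eight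
  -- epipolar rows it can give an invertible matrix, although the epipolar rows alone always have a
  -- kernel.
  let u : Fin 9 → K := Pi.single (e (i₀, j₀)) 1
  have hu : ∀ E, u ⬝ᵥ vec E = E i₀ j₀ := fun E => by simp [u, vec]
  let f : (Fin 3 → K) → Fin 9 → K := fun P j => epipolarRow M t P (e.symm j)
  have hf : ∀ P E, f P ⬝ᵥ vec E = (M *ᵥ P + t) ⬝ᵥ E *ᵥ P := fun P E =>
    epipolarRow_dotProduct M E t P
  have hvec : ∀ v, ∃ E, v = vec E := fun v =>
    ⟨Matrix.of fun i j => v (e (i, j)), by ext j; simp [vec]⟩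
  let W : (Fin n → Fin 3 → K) → Matrix (Fin 9) (Fin 9) K := fun P =>
    Matrix.of (Fin.cons u fun i : Fin 8 => f (P (i.castLE hn)))
  let WX : Matrix (Fin 9) (Fin 9) (MvPolynomial (Fin n × Fin 3) K) :=
    Matrix.of (Fin.cons (fun j => MvPolynomial.C (u j)) fun (i : Fin 8) j =>
      epipolarRow (M.map MvPolynomial.C) (MvPolynomial.C ∘ t)
        (fun l => MvPolynomial.X (i.castLE hn, l)) (e.symm j))
  have heval : ∀ P : Fin n → Fin 3 → K,
      MvPolynomial.eval (fun ij => P ij.1 ij.2) WX.det = (W P).det := fun P => by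
    rw [RingHom.map_det]
    congr 1
    ext i j
    refine Fin.cases ?_ (fun i => ?_) i
    · simp [WX, W]
    · simp only [RingHom.mapMatrix_apply, map_apply, WX, of_apply, Fin.cons_succ,
        map_epipolarRow, W, f]
      congr 1
      · ext; simp
      · ext; simp
      · ext; simp
  refine ⟨WX.det, ?_, fun P hP E hE hPE => ?_⟩
  · obtain ⟨x, hx⟩ := exists_linearIndependent_cons f (u := u) (by simp [u]) (fun v h1 h2 => by
      obtain ⟨E, rfl⟩ := hvec v
      obtain ⟨r, rfl⟩ := exists_eq_smul_essentialMatrix hM ht fun P => (hf P E).symm.trans (h2 P)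
      rw [hu, Matrix.smul_apply, smul_eq_mul] at h1
      rw [(mul_eq_zero.1 h1).resolve_right hj₀]
      ext; simp [vec]) 8 (by simp)
    obtain ⟨Q, hQ⟩ : ∃ Q : Fin n → Fin 3 → K, ∀ i : Fin 8, Q (i.castLE hn) = x i :=
      ⟨fun i => if h : (i : ℕ) < 8 then x ⟨i, h⟩ else 0, fun i => by simp⟩
    have hdet : (W Q).det ≠ 0 := by
      rw [← isUnit_iff_ne_zero, ← isUnit_iff_isUnit_det, ← linearIndependent_rows_iff_isUnit]
      simp only [W, hQ]
      exact hx
    intro h0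
    rw [← heval, h0, map_zero] at hdet
    exact hdet rfl
  · rw [heval] at hP
    -- The multiple is chosen so that the difference vanishes at the entry `(i₀, j₀)`; the epipolar
    -- rows kill both terms.
    have hzero : W P *ᵥ vec (E - (E i₀ j₀ / essentialMatrix M t i₀ j₀) • essentialMatrix M t)
        = 0 := by
      ext i
      refine Fin.cases ?_ (fun i => ?_) i
      · refine (hu _).trans ?_
        simp [hj₀]
      · refine (hf _ _).trans ?_
        rw [sub_mulVec, dotProduct_sub, hPE, smul_mulVec, dotProduct_smul, essentialMatrix,
          ← mulVec_mulVec]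
        have : (M *ᵥ P (i.castLE hn) + t) ⬝ᵥ crossMatrix t *ᵥ (M *ᵥ P (i.castLE hn)) = 0 := by
          rw [← dotProduct_crossMatrix_mulVec_self t (M *ᵥ P (i.castLE hn) + t), mulVec_add,
            crossMatrix_mulVec_self, add_zero]
        rw [this, smul_zero, sub_zero]; rfl
    have hEq : E = (E i₀ j₀ / essentialMatrix M t i₀ j₀) • essentialMatrix M t := by
      have h0 := eq_zero_of_mulVec_eq_zero hP hzero
      ext i j
      have := congrFun h0 (e (i, j))
      simpa [vec, sub_eq_zero] using this
    refine ⟨_, ?_, hEq⟩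
    intro h0
    rw [h0, zero_smul] at hEq
    rw [hEq, rank_zero] at hE
    omega

theorem ProjEq.symm {V : Type*} [AddCommGroup V] [Module K V] {x y : V}
    (h : ProjEq (K := K) x y) : ProjEq (K := K) y x := by
  obtain ⟨s, hs, rfl⟩ := h
  exact ⟨s⁻¹, inv_ne_zero hs, (inv_smul_smul₀ hs x).symm⟩

theorem ProjEq.trans {V : Type*} [AddCommGroup V] [Module K V] {x y z : V}
    (h : ProjEq (K := K) x y) (h' : ProjEq (K := K) y z) : ProjEq (K := K) x z := by
  obtain ⟨s, hs, rfl⟩ := h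
  obtain ⟨r, hr, rfl⟩ := h'
  exact ⟨r * s, mul_ne_zero hr hs, smul_smul r s x⟩

/-- Any deformation with the same two images has a proportional essential matrix, and it is not
a pure linear map. -/
theorem DeterminesEssential.projEq {n : ℕ} {M N : Matrix (Fin 3) (Fin 3) K} {t u : Fin 3 → K}
    {P Q : Fin n → Fin 3 → K} (h : DeterminesEssential M t P) (hN : N.det ≠ 0)
    (h1 : ∀ i, ProjEq (K := K) (P i) (Q i))
    (h2 : ∀ i, ProjEq (K := K) (M *ᵥ P i + t) (N *ᵥ Q i + u)) :
    ProjEq (K := K) (essentialMatrix M t) (essentialMatrix N u) := by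
  -- Any nonzero `w` with `w × u = 0` yields a rank-two solution of the epipolar equations. If `u =
  -- 0`, two independent choices of `w` would give proportional essential matrices, which is
  -- impossible.
  have key : ∀ w, w ≠ 0 → crossMatrix w *ᵥ u = 0 →
      ProjEq (K := K) (essentialMatrix M t) (essentialMatrix N w) := fun w hw hwu => by
    refine h _ (rank_essentialMatrix hN hw) fun i => ?_
    obtain ⟨r, hr, hr'⟩ := h1 i
    obtain ⟨s, hs, hs'⟩ := h2 i
    have h3 := dotProduct_crossMatrix_mulVec_self w (N *ᵥ Q i + u)
    rw [mulVec_add (crossMatrix w), hwu, add_zero, hs', hr', mulVec_smul, mulVec_smul,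
      smul_dotProduct, dotProduct_smul, smul_smul, smul_eq_zero] at h3
    rw [essentialMatrix, ← mulVec_mulVec]
    exact h3.resolve_left (mul_ne_zero hs hr)
  by_cases hu : u = 0
  · exfalso
    have hx : ∀ w : Fin 3 → K, w ≠ 0 → ProjEq (K := K) (essentialMatrix M t) (essentialMatrix N w) :=
      fun w hw => key w hw (by rw [hu, mulVec_zero])
    have hw0 : (![1, 0, 0] : Fin 3 → K) ≠ 0 := fun h => one_ne_zero (congrFun h 0)
    have hw1 : (![0, 1, 0] : Fin 3 → K) ≠ 0 := fun h => one_ne_zero (congrFun h 1)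
    obtain ⟨s, hs, h3⟩ := (hx _ hw0).symm.trans (hx _ hw1)
    obtain ⟨k, w, hk, h4, -⟩ := exists_of_essentialMatrix_eq_smul hN hw0 hs h3
    simpa using congrFun h4 1
  · exact key u hu (crossMatrix_mulVec_self u)

end Generic

/-! ### The reconstruction system: finiteness and uniqueness. -/

section System

variable {K : Type*} [Field K]

/-- A point of the system variety is a quasi-identical pair of deformations with the same
essential matrices up to scale. -/
theorem exists_of_mem_systemVariety {A A₀ C₀ : Matrix (Fin 3) (Fin 3) K} {a a₀ c₀ : Fin 3 → K}
    {lam mu s s' : K} (hA : krylovDet A a ≠ 0) (hdet : A.det ≠ 0) (hl : lam ≠ 0)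
    (hs : s ≠ 0) (hs' : s' ≠ 0) (h12 : essentialMatrix A₀ a₀ = s • essentialMatrix A a)
    (h13 : essentialMatrix C₀ c₀ =
      s' • essentialMatrix (totalLinear A lam) (totalTranslation A a lam mu))
    {p : Unknowns K} (hp : p ∈ systemVariety A₀ a₀ C₀ c₀ lam mu) :
    ∃ (σ k : K), ∃ v ∈ ambiguitySet A a lam mu, σ ≠ 0 ∧ k ≠ 0 ∧ a₀ = k • a ∧
      A₀ + vecMulVec a₀ p.v₁ = σ • (A + vecMulVec a v) ∧
      p.α * mu = σ * (mu - lam * (v ⬝ᵥ a)) ∧ s = k * σ ∧ p.α ^ 2 * s' = k * σ ^ 3 := by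
  obtain ⟨e1, e2, e3, e4⟩ := hp
  have hα : p.α ≠ 0 := left_ne_zero_of_mul_eq_one (sub_eq_zero.1 e3)
  have hγ : p.γ ≠ 0 := left_ne_zero_of_mul_eq_one (sub_eq_zero.1 e4)
  have ht : totalTranslation (A₀ + vecMulVec a₀ p.v₁) a₀ lam (p.α * mu) = p.γ • c₀ := by
    rw [totalTranslation_eq]; exact sub_eq_zero.1 e1
  have hL : p.γ • totalLinear (A₀ + vecMulVec a₀ p.v₁) lam =
      p.α ^ 2 • (C₀ + vecMulVec c₀ p.v₃) := by
    rw [totalLinear, smul_mul, smul_smul, ← pow_two, mul_comm]; exact sub_eq_zero.1 e2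
  obtain ⟨σ, k, v, hv, hσ, hk, h1, h2, h3, h4, h5⟩ :=
    -- A point of the variety is the pair `(A₀ + a₀ v₁ᵀ, a₀)` with scalars `lam` and `α mu`; the
    -- second equation multiplies the (1,3) essential matrix by `α²`.
    exists_mem_ambiguitySet (A' := A₀ + vecMulVec a₀ p.v₁) (a' := a₀) (lam' := lam)
      (mu' := p.α * mu) (s := s) (s' := p.α ^ 2 * s') hA hdet hl hl hs
      (mul_ne_zero (pow_ne_zero _ hα) hs')
      (by rw [← h12, essentialMatrix, mul_add, crossMatrix_mul_vecMulVec, add_zero,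
        essentialMatrix])
      (by rw [← smul_smul, ← h13, ht, essentialMatrix, crossMatrix_smul, smul_mul,
        ← Matrix.mul_smul, hL, Matrix.mul_smul, mul_add, crossMatrix_mul_vecMulVec, add_zero,
        essentialMatrix])
  refine ⟨σ, k, v, hv, hσ, hk, h1, h2, ?_, h4, ?_⟩
  · refine mul_right_cancel₀ hl ?_
    linear_combination h3
  · refine mul_right_cancel₀ (pow_ne_zero 2 hl) ?_
    linear_combination h5

theorem vecMulVec_right_injective {a : Fin 3 → K} (ha : a ≠ 0) :
    Function.Injective (vecMulVec a : (Fin 3 → K) → Matrix (Fin 3) (Fin 3) K) := by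
  intro v w h
  obtain ⟨i, hi⟩ := Function.ne_iff.1 ha
  ext j
  have := congrFun (congrFun h i) j
  rw [vecMulVec_apply, vecMulVec_apply] at this
  exact mul_left_cancel₀ hi this

/-- The vector `v₁` determines a point of the system variety. -/
theorem systemVariety_injOn {A₀ C₀ : Matrix (Fin 3) (Fin 3) K} {a₀ c₀ : Fin 3 → K}
    {lam mu : K} (hmu : mu ≠ 0) (hc : ∀ x y : K, x • c₀ + y • a₀ = 0 → x = 0 ∧ y = 0) :
    Set.InjOn Unknowns.v₁ (systemVariety A₀ a₀ C₀ c₀ lam mu) := by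
  have hc₀ : c₀ ≠ 0 := by
    rintro rfl
    exact one_ne_zero (hc 1 0 (by simp)).1
  rintro ⟨α, γ, x, z, v, w⟩ ⟨e1, e2, e3, e4⟩ ⟨α', γ', x', z', v', w'⟩ ⟨f1, f2, f3, f4⟩ h
  simp only at h e1 e2 e3 e4 f1 f2 f3 f4
  subst h
  obtain ⟨h1, h2⟩ := hc (γ' - γ) (α * mu - α' * mu) (by
    rw [sub_smul, sub_smul, ← sub_eq_zero.2 (e1.trans f1.symm)]; abel)
  obtain rfl : γ' = γ := sub_eq_zero.1 h1
  obtain rfl : α = α' := mul_right_cancel₀ hmu (sub_eq_zero.1 h2)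
  have hα : α ≠ 0 := left_ne_zero_of_mul_eq_one (sub_eq_zero.1 e3)
  have hγ : γ' ≠ 0 := left_ne_zero_of_mul_eq_one (sub_eq_zero.1 e4)
  obtain rfl : x = x' := mul_left_cancel₀ hα ((sub_eq_zero.1 e3).trans (sub_eq_zero.1 f3).symm)
  obtain rfl : z = z' := mul_left_cancel₀ hγ ((sub_eq_zero.1 e4).trans (sub_eq_zero.1 f4).symm)
  have h3 := smul_right_injective _ (pow_ne_zero 2 hα) (sub_right_injective (e2.trans f2.symm))
  rw [vecMulVec_right_injective hc₀ (add_left_cancel h3)]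

theorem totalTranslation_independent {A : Matrix (Fin 3) (Fin 3) K} {a a₀ c₀ : Fin 3 → K}
    {lam mu k k' : K} (hA : krylovDet A a ≠ 0) (hl : lam ≠ 0) (hk : k ≠ 0) (hk' : k' ≠ 0)
    (ha₀ : a₀ = k • a) (hc₀ : c₀ = k' • totalTranslation A a lam mu) {x y : K}
    (h : x • c₀ + y • a₀ = 0) : x = 0 ∧ y = 0 := by
  obtain ⟨h1, h2⟩ := eq_zero_of_smul_add_smul_eq_zero hA (x := x * k' * lam)
    (y := x * k' * mu + y * k) (by
      rw [← h, ha₀, hc₀, totalTranslation_eq]; module)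
  have hx : x = 0 := by simpa [hk', hl] using h1
  subst hx
  exact ⟨rfl, by simpa [hk] using h2⟩

/-- A point is determined by its `v₁`, and `v₁` is an affine function of a vector in the finite
ambiguity set. -/
theorem systemVariety_finite {A A₀ C₀ : Matrix (Fin 3) (Fin 3) K} {a a₀ c₀ : Fin 3 → K}
    {lam mu s s' : K} (hA : krylovDet A a ≠ 0) (hdet : A.det ≠ 0) (hl : lam ≠ 0) (hmu : mu ≠ 0)
    (hs : s ≠ 0) (hs' : s' ≠ 0) (h12 : essentialMatrix A₀ a₀ = s • essentialMatrix A a)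
    (h13 : essentialMatrix C₀ c₀ =
      s' • essentialMatrix (totalLinear A lam) (totalTranslation A a lam mu)) :
    (systemVariety A₀ a₀ C₀ c₀ lam mu).Finite := by
  have ha := ne_zero_of_krylovDet_ne_zero hA
  obtain ⟨k, w, hk, ha₀, hA₀⟩ := exists_of_essentialMatrix_eq_smul hdet ha hs h12
  obtain ⟨k', w', hk', hc₀, -⟩ := exists_of_essentialMatrix_eq_smul
    (det_totalLinear_ne_zero hdet hl) (totalTranslation_ne_zero hA hl) hs' h13
  refine Set.Finite.of_finite_image (f := Unknowns.v₁) (((ambiguitySet_finite hA hl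
    (mu := mu)).image fun v => k⁻¹ • ((s / k) • v - w)).subset ?_)
    (systemVariety_injOn hmu fun x y => totalTranslation_independent hA hl hk hk' ha₀ hc₀)
  rintro _ ⟨p, hp, rfl⟩
  obtain ⟨σ, k₁, v, hv, -, -, h1, h2, -, h4, -⟩ :=
    exists_of_mem_systemVariety hA hdet hl hs hs' h12 h13 hp
  refine ⟨v, hv, ?_⟩
  obtain rfl : k = k₁ := smul_left_injective K ha (ha₀.symm.trans h1)
  have hσ : s / k = σ := by rw [h4]; field_simp
  have : vecMulVec a (k • p.v₁ + w) = vecMulVec a (σ • v) := by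
    rw [hA₀, ha₀, hσ, smul_vecMulVec, smul_add, add_assoc] at h2
    have := add_left_cancel h2
    rw [vecMulVec_add, vecMulVec_smul, vecMulVec_smul, ← this, add_comm]
  simp only [hσ]
  rw [← vecMulVec_right_injective ha this, add_sub_cancel_right, inv_smul_smul₀ hk]

/-- If neither `mu / lam` nor its negative is an eigenvalue of `A`, the ambiguity set has no
nonzero vector that belongs to a change of scale by `1` or `-1`. -/
theorem eq_zero_of_mem_ambiguitySet {A : Matrix (Fin 3) (Fin 3) K} {a v : Fin 3 → K}
    {lam mu ε : K} (h1 : (lam • A - mu • (1 : Matrix (Fin 3) (Fin 3) K)).det ≠ 0)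
    (h2 : (lam • A + mu • (1 : Matrix (Fin 3) (Fin 3) K)).det ≠ 0)
    (hv : v ∈ ambiguitySet A a lam mu) (hε : ε ^ 2 = 1)
    (h : ε * mu = mu - lam * (v ⬝ᵥ a)) : v = 0 := by
  have hvA : v ᵥ* (lam • A) = (ε * mu) • v := by
    have := hv.out
    rw [smul_add, smul_smul, ← vecMul_smul, ← eq_sub_iff_add_eq, ← sub_smul] at this
    rw [this, h]
  rcases (mul_self_eq_one_iff.1 ((pow_two ε).symm.trans hε)) with rfl | rfl
  · refine eq_zero_of_vecMul_eq_zero h1 ?_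
    rw [vecMul_sub, hvA, vecMul_smul, vecMul_one, one_mul, sub_self]
  · refine eq_zero_of_vecMul_eq_zero h2 ?_
    rw [vecMul_add, hvA, vecMul_smul, vecMul_one, neg_one_mul, neg_smul, neg_add_cancel]

theorem exists_systemVariety_eq_singleton {A A₀ C₀ : Matrix (Fin 3) (Fin 3) K}
    {a a₀ c₀ : Fin 3 → K} {lam mu : K} (hA : krylovDet A a ≠ 0) (hdet : A.det ≠ 0)
    (hl : lam ≠ 0) (hmu : mu ≠ 0)
    (h1 : (lam • A - mu • (1 : Matrix (Fin 3) (Fin 3) K)).det ≠ 0)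
    (h2 : (lam • A + mu • (1 : Matrix (Fin 3) (Fin 3) K)).det ≠ 0)
    (h12 : essentialMatrix A₀ a₀ = essentialMatrix A a)
    (h13 : essentialMatrix C₀ c₀ =
      essentialMatrix (totalLinear A lam) (totalTranslation A a lam mu)) :
    ∃ p : Unknowns K, systemVariety A₀ a₀ C₀ c₀ lam mu = {p} ∧
      a = p.α • a₀ ∧ A = p.α⁻¹ • (A₀ + vecMulVec a₀ p.v₁) ∧
      totalTranslation A a lam mu = p.γ • c₀ ∧
      totalLinear A lam = p.γ⁻¹ • (C₀ + vecMulVec c₀ p.v₃) := by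
  have ha := ne_zero_of_krylovDet_ne_zero hA
  rw [← one_smul K (essentialMatrix A a)] at h12
  rw [← one_smul K (essentialMatrix (totalLinear A lam) _)] at h13
  obtain ⟨k, w, hk, ha₀, hA₀⟩ := exists_of_essentialMatrix_eq_smul hdet ha one_ne_zero h12
  obtain ⟨k', w', hk', hc₀, hC₀⟩ := exists_of_essentialMatrix_eq_smul
    (det_totalLinear_ne_zero hdet hl) (totalTranslation_ne_zero hA hl) one_ne_zero h13
  have e1 : a = k⁻¹ • a₀ := by rw [ha₀, inv_smul_smul₀ hk]
  have e2 : A = k • (A₀ + vecMulVec a₀ (-k⁻¹ • w)) := by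
    rw [hA₀, ha₀, smul_vecMulVec, vecMulVec_smul, smul_smul, mul_neg, mul_inv_cancel₀ hk, neg_smul,
      one_smul, add_neg_cancel_right, smul_smul, mul_one_div_cancel hk, one_smul]
  have e3 : totalTranslation A a lam mu = k'⁻¹ • c₀ := by rw [hc₀, inv_smul_smul₀ hk']
  have e4 : totalLinear A lam = k' • (C₀ + vecMulVec c₀ (-k'⁻¹ • w')) := by
    rw [hC₀, hc₀, smul_vecMulVec, vecMulVec_smul, smul_smul, mul_neg, mul_inv_cancel₀ hk', neg_smul,
      one_smul, add_neg_cancel_right, smul_smul, mul_one_div_cancel hk', one_smul]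
  have hB : A₀ + vecMulVec a₀ (-k⁻¹ • w) = k⁻¹ • A :=
    ((inv_smul_eq_iff₀ hk).2 e2).symm
  have hD : C₀ + vecMulVec c₀ (-k'⁻¹ • w') = k'⁻¹ • totalLinear A lam :=
    ((inv_smul_eq_iff₀ hk').2 e4).symm
  -- The true deformations, written in the given factorizations; `α` and `γ` undo the scales `k` and
  -- `k'`.
  obtain ⟨p, hp⟩ : ∃ p : Unknowns K, p = ⟨k⁻¹, k'⁻¹, k, k', -k⁻¹ • w, -k'⁻¹ • w'⟩ := ⟨_, rfl⟩
  have hmem : p ∈ systemVariety A₀ a₀ C₀ c₀ lam mu := by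
    rw [hp]
    refine ⟨?_, ?_, ?_, ?_⟩
    · simp only
      rw [hB, ← e3, totalTranslation_eq, ha₀, mulVec_smul, smul_mulVec, smul_inv_smul₀ hk,
        mul_comm, ← smul_smul mu, inv_smul_smul₀ hk, sub_self]
    · simp only
      rw [hB, hD, totalLinear, smul_pow, pow_two A, smul_mul]
      module
    · simp [hk]
    · simp [hk']
  refine ⟨p, Set.eq_singleton_iff_unique_mem.2 ⟨hmem, fun q hq => ?_⟩, by rw [hp, ← e1],
    by simpa [hp] using e2, by rw [hp, ← e3], by simpa [hp] using e4⟩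
  refine systemVariety_injOn hmu (fun x y => totalTranslation_independent hA hl hk hk' ha₀ hc₀)
    hq hmem ?_
  obtain ⟨σ, k₁, v, hv, hσ, -, f1, f2, f3, f4, f5⟩ :=
    exists_of_mem_systemVariety hA hdet hl one_ne_zero one_ne_zero h12 h13 hq
  obtain rfl : k = k₁ := smul_left_injective K ha (ha₀.symm.trans f1)
  have hv0 : v = 0 := by
    -- With both essential matrices exact, `k σ = 1` and `α² = k σ³ = σ²`, so `α / σ` is `1` or
    -- `-1`.
    refine eq_zero_of_mem_ambiguitySet (ε := q.α / σ) h1 h2 hv ?_ ?_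
    · field_simp
      linear_combination f5 - σ ^ 2 * f4
    · field_simp
      linear_combination f3
  have hσk : σ = k⁻¹ := eq_inv_of_mul_eq_one_right f4.symm
  rw [hv0, vecMulVec_zero, add_zero, hσk, ← hB] at f2
  rw [hp]
  exact vecMulVec_right_injective (ha₀ ▸ smul_ne_zero hk ha) (add_left_cancel f2)

/-- The essential matrices and the scalars determine the deformations. -/
theorem eq_of_essentialMatrix_eq {A A' : Matrix (Fin 3) (Fin 3) K} {a a' : Fin 3 → K}
    {lam mu : K} (hA : krylovDet A a ≠ 0) (hdet : A.det ≠ 0) (hl : lam ≠ 0) (hmu : mu ≠ 0)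
    (h1 : (lam • A - mu • (1 : Matrix (Fin 3) (Fin 3) K)).det ≠ 0)
    (h2 : (lam • A + mu • (1 : Matrix (Fin 3) (Fin 3) K)).det ≠ 0)
    (h12 : essentialMatrix A' a' = essentialMatrix A a)
    (h13 : essentialMatrix (totalLinear A' lam) (totalTranslation A' a' lam mu) =
      essentialMatrix (totalLinear A lam) (totalTranslation A a lam mu)) : A' = A ∧ a' = a := by
  obtain ⟨p, hp, e1, e2, -, -⟩ :=
    exists_systemVariety_eq_singleton hA hdet hl hmu h1 h2 h12 h13
  -- The competing pair, used as its own factorization, solves the system trivially; by uniqueness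
  -- this is the point that recovers `A` and `a`.
  have hmem : (⟨1, 1, 1, 1, 0, 0⟩ : Unknowns K) ∈ systemVariety A' a' (totalLinear A' lam)
      (totalTranslation A' a' lam mu) lam mu := by
    simp [systemVariety, totalTranslation_eq, totalLinear, pow_two]
  rw [hp, Set.mem_singleton_iff] at hmem
  rw [← hmem] at e1 e2
  exact ⟨by simpa using e2.symm, by simpa using e1.symm⟩

end System

/-! ### From deformations to scenes with the same images. -/

section Scenes

variable {K : Type*} [Field K] {n : ℕ}

namespace Scene

theorem third_eq (R : Scene K n) (i : Fin n) : R.third i =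
    totalLinear R.A R.lam *ᵥ R.P i + totalTranslation R.A R.a R.lam R.mu := by
  rw [third, second, totalLinear, totalTranslation, mulVec_add, mulVec_mulVec, add_assoc]

theorem SameImages.symm {R R' : Scene K n} (h : SameImages R R') : SameImages R' R :=
  fun i => ⟨(h i).1.symm, (h i).2.1.symm, (h i).2.2.symm⟩

theorem SameImages.trans {R R' R'' : Scene K n} (h : SameImages R R') (h' : SameImages R' R'') :
    SameImages R R'' :=
  fun i => ⟨(h i).1.trans (h' i).1, (h i).2.1.trans (h' i).2.1, (h i).2.2.trans (h' i).2.2⟩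

theorem second_rescale (R : Scene K n) {s k : K} (g : K) (hs : s ≠ 0) (i : Fin n) :
    (R.rescale s k g).second i = k • R.second i := by
  simp only [second, rescale, mulVec_smul, smul_mulVec, smul_add, smul_smul, div_mul_cancel₀ _ hs]

theorem third_rescale (R : Scene K n) {s k : K} (g : K) (hs : s ≠ 0) (i : Fin n) :
    (R.rescale s k g).third i = (g * k) • R.third i := by
  rw [third, second_rescale R g hs]
  simp only [third, rescale, mulVec_smul, smul_mulVec, smul_add, smul_smul]
  congr 2
  · field_simp
  · ring

theorem sameImages_rescale (R : Scene K n) {s k g : K} (hs : s ≠ 0) (hk : k ≠ 0) (hg : g ≠ 0) :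
    SameImages R (R.rescale s k g) :=
  fun i => ⟨⟨k / s, div_ne_zero hk hs, rfl⟩, ⟨k, hk, second_rescale R g hs i⟩,
    ⟨g * k, mul_ne_zero hg hk, third_rescale R g hs i⟩⟩

theorem Valid.rescale {R : Scene K n} (hR : R.Valid) {s k g : K} (hs : s ≠ 0) (hg : g ≠ 0) :
    (R.rescale s k g).Valid := by
  refine ⟨?_, mul_ne_zero (div_ne_zero hg hs) hR.2.1, mul_ne_zero hg hR.2.2⟩
  rw [Scene.rescale, det_smul]
  exact mul_ne_zero (pow_ne_zero _ hs) hR.1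

theorem rescale_rescale_inv (R : Scene K n) {s k g : K} (hs : s ≠ 0) (hk : k ≠ 0) (hg : g ≠ 0) :
    (R.rescale s k g).rescale s⁻¹ k⁻¹ g⁻¹ = R := by
  cases R
  simp only [rescale, smul_smul, Scene.mk.injEq]
  refine ⟨?_, ?_, ?_, ?_, ?_⟩
  · rw [inv_mul_cancel₀ hs, one_smul]
  · rw [inv_mul_cancel₀ hk, one_smul]
  · field_simp
  · field_simp
  · ext i : 1
    rw [show k⁻¹ / s⁻¹ * (k / s) = 1 by field_simp, one_smul]

/-- The deformations and the images determine the points. -/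
theorem SameImages.eq_of_deformations_eq {R R' : Scene K n} (h : SameImages R R') (hR : R.Valid)
    (hind : ∀ x y : K, x • R.A *ᵥ R.a + y • R.a = 0 → x = 0 ∧ y = 0) (hA : R'.A = R.A)
    (ha : R'.a = R.a) (hl : R'.lam = R.lam) (hm : R'.mu = R.mu) : R' = R := by
  obtain ⟨hdet, hl0, hm0⟩ := hR
  have hP : R'.P = R.P := by
    ext i : 1
    obtain ⟨⟨r, -, h1⟩, ⟨s, -, h2⟩, ⟨t, -, h3⟩⟩ := h i
    rw [third_eq, third_eq, hA, ha, hl, hm, h1] at h3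
    rw [second, second, hA, ha, h1] at h2
    rw [h1]
    have ha0 : R.a ≠ 0 := fun h0 => one_ne_zero (hind 0 1 (by rw [h0]; simp)).2
    have hc0 : totalTranslation R.A R.a R.lam R.mu ≠ 0 := fun h0 =>
      hl0 (hind R.lam R.mu (by rw [← totalTranslation_eq, h0])).1
    -- If the depth changes by `r ≠ 1`, then `(r - s) M P = (s - 1) u`, so `M P` is parallel to the
    -- translation. Holding for both deformations, this forces `P = 0`, which rescaling does not
    -- move.
    have aux : ∀ {M : Matrix (Fin 3) (Fin 3) K} {u : Fin 3 → K} {s : K}, u ≠ 0 → r ≠ 1 →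
        M *ᵥ (r • R.P i) + u = s • (M *ᵥ R.P i + u) → ∃ x : K, M *ᵥ R.P i = x • u := by
      intro M u s hu hr h
      have h' : (r - s) • M *ᵥ R.P i = (s - 1) • u := by
        rw [mulVec_smul, smul_add] at h
        rw [sub_smul, sub_smul, one_smul, sub_eq_sub_iff_add_eq_add, h]; abel
      have hrs : r - s ≠ 0 := by
        intro h0
        rw [h0, zero_smul] at h'
        have := (smul_eq_zero.1 h'.symm).resolve_right hu
        exact hr (by linear_combination h0 + this)
      exact ⟨(r - s)⁻¹ * (s - 1), by rw [← smul_smul, ← h', inv_smul_smul₀ hrs]⟩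
    by_cases hr : r = 1
    · rw [hr, one_smul]
    · obtain ⟨x, hx⟩ := aux ha0 hr h2
      obtain ⟨y, hy⟩ := aux hc0 hr h3
      rw [totalLinear, smul_mul, smul_mulVec, ← mulVec_mulVec, hx, mulVec_smul,
        totalTranslation_eq] at hy
      obtain ⟨h4, h5⟩ := hind (R.lam * x - y * R.lam) (-(y * R.mu)) (by
        rw [sub_smul, mul_smul, hy]; module)
      have hy0 : y = 0 := by simpa [hm0] using h5
      have hx0 : x = 0 := by simpa [hy0, hl0] using h4
      rw [hx0, zero_smul] at hx
      rw [eq_zero_of_mulVec_eq_zero hdet hx, smul_zero]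
  cases R; cases R'
  simp_all

/-- The scenes with given images and finitely many possible deformations. -/
theorem finite_setOf_sameImages (R₀ : Scene K n)
    {F : Set (Matrix (Fin 3) (Fin 3) K × (Fin 3 → K) × K × K)} (hF : F.Finite)
    (hind : ∀ q ∈ F, ∀ x y : K, x • q.1 *ᵥ q.2.1 + y • q.2.1 = 0 → x = 0 ∧ y = 0) :
    {R : Scene K n | R.Valid ∧ SameImages R₀ R ∧ (R.A, R.a, R.lam, R.mu) ∈ F}.Finite := by
  refine Set.Finite.of_finite_image (f := fun R : Scene K n => (R.A, R.a, R.lam, R.mu))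
    (hF.subset ?_) ?_
  · rintro _ ⟨R, hR, rfl⟩
    exact hR.2.2
  · rintro R ⟨-, hR, -⟩ R' ⟨hV', hR', hF'⟩ h
    simp only [Prod.mk.injEq] at h
    exact (hR'.symm.trans hR).eq_of_deformations_eq hV' (hind _ hF') h.1 h.2.1 h.2.2.1 h.2.2.2

end Scene

/-- Adding `a vᵀ` changes `A a` only by a multiple of `a`. -/
theorem independent_add_vecMulVec {A : Matrix (Fin 3) (Fin 3) K} {a : Fin 3 → K}
    (hA : krylovDet A a ≠ 0) {r : K} (hr : r ≠ 0) (v : Fin 3 → K) {x y : K}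
    (h : x • (r • (A + vecMulVec a v)) *ᵥ a + y • a = 0) : x = 0 ∧ y = 0 := by
  rw [smul_mulVec, add_mulVec, mulVec_vecMulVec_mulVec] at h
  obtain ⟨h1, h2⟩ := eq_zero_of_smul_add_smul_eq_zero hA (x := x * r)
    (y := x * r * (v ⬝ᵥ a) + y) (by rw [← h]; module)
  have hx : x = 0 := (mul_eq_zero.1 h1).resolve_right hr
  exact ⟨hx, by simpa [hx] using h2⟩

/-- Any scene with the same images has deformations in the ambiguity set, up to scales. -/
theorem exists_of_sameImages {A : Matrix (Fin 3) (Fin 3) K} {a : Fin 3 → K} {lam mu : K}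
    (hA : krylovDet A a ≠ 0) (hdet : A.det ≠ 0) (hl : lam ≠ 0) {P : Fin n → Fin 3 → K}
    (h12 : DeterminesEssential A a P)
    (h13 : DeterminesEssential (totalLinear A lam) (totalTranslation A a lam mu) P)
    {R : Scene K n} (hR : R.Valid) (h : Scene.SameImages ⟨A, a, lam, mu, P⟩ R) :
    ∃ (σ k : K), ∃ v ∈ ambiguitySet A a lam mu, σ ≠ 0 ∧ k ≠ 0 ∧ R.a = k • a ∧
      R.A = σ • (A + vecMulVec a v) ∧ R.mu * lam = R.lam * σ * (mu - lam * (v ⬝ᵥ a)) := by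
  obtain ⟨s, hs, h1⟩ := h12.projEq hR.1 (fun i => (h i).1) (fun i => (h i).2.1)
  obtain ⟨s', hs', h2⟩ := h13.projEq (det_totalLinear_ne_zero hR.1 hR.2.1) (fun i => (h i).1)
    (fun i => by
      have := (h i).2.2
      rwa [Scene.third_eq, Scene.third_eq] at this)
  obtain ⟨σ, k, v, hv, hσ, hk, e1, e2, e3, -, -⟩ :=
    exists_mem_ambiguitySet hA hdet hl hR.2.1 hs hs' h1 h2
  exact ⟨σ, k, v, hv, hσ, hk, e1, e2, e3⟩

theorem exists_finite_scenes {A : Matrix (Fin 3) (Fin 3) K} {a : Fin 3 → K} {lam mu : K}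
    (hA : krylovDet A a ≠ 0) (hdet : A.det ≠ 0) (hl : lam ≠ 0) {P : Fin n → Fin 3 → K}
    (h12 : DeterminesEssential A a P)
    (h13 : DeterminesEssential (totalLinear A lam) (totalTranslation A a lam mu) P) :
    ∃ S : Set (Scene K n), S.Finite ∧ ∀ R : Scene K n, R.Valid →
      Scene.SameImages ⟨A, a, lam, mu, P⟩ R →
      ∃ R₁ ∈ S, ∃ s k g : K, s ≠ 0 ∧ k ≠ 0 ∧ g ≠ 0 ∧ R = R₁.rescale s k g := by
  refine ⟨_, Scene.finite_setOf_sameImages ⟨A, a, lam, mu, P⟩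
    ((ambiguitySet_finite hA hl (mu := mu)).image fun v =>
      (A + vecMulVec a v, a, lam, mu - lam * (v ⬝ᵥ a))) ?_, fun R hR h => ?_⟩
  · rintro _ ⟨v, -, rfl⟩ x y hxy
    exact independent_add_vecMulVec hA one_ne_zero v (by rwa [one_smul])
  · obtain ⟨σ, k, v, hv, hσ, hk, e1, e2, e3⟩ := exists_of_sameImages hA hdet hl h12 h13 hR h
    have hl' := hR.2.1
    have hg : lam / (σ * R.lam) ≠ 0 := div_ne_zero hl (mul_ne_zero hσ hl')
    -- The three scales normalize the linear part to `A + a vᵀ`, the translation to `a` and the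
    -- first scalar to `lam`; the second scalar is then forced.
    refine ⟨R.rescale σ⁻¹ k⁻¹ (lam / (σ * R.lam)), ⟨hR.rescale (inv_ne_zero hσ) hg,
      h.trans (R.sameImages_rescale (inv_ne_zero hσ) (inv_ne_zero hk) hg), v, hv, ?_⟩,
      σ, k, (lam / (σ * R.lam))⁻¹, hσ, hk, inv_ne_zero hg, ?_⟩
    · simp only [Scene.rescale, Prod.mk.injEq]
      refine ⟨?_, ?_, ?_, ?_⟩
      · rw [e2, inv_smul_smul₀ hσ]
      · rw [e1, inv_smul_smul₀ hk]
      · field_simp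
      · field_simp
        linear_combination -e3
    · have := R.rescale_rescale_inv (inv_ne_zero hσ) (inv_ne_zero hk) hg
      rw [inv_inv, inv_inv] at this
      exact this.symm

theorem exists_finite_scenes_of_scalars {A : Matrix (Fin 3) (Fin 3) K} {a : Fin 3 → K}
    {lam mu : K} (hA : krylovDet A a ≠ 0) (hdet : A.det ≠ 0) (hl : lam ≠ 0) (hmu : mu ≠ 0)
    {P : Fin n → Fin 3 → K} (h12 : DeterminesEssential A a P)
    (h13 : DeterminesEssential (totalLinear A lam) (totalTranslation A a lam mu) P) :
    ∃ S : Set (Scene K n), S.Finite ∧ ∀ R : Scene K n, R.Valid → R.lam = lam → R.mu = mu →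
      Scene.SameImages ⟨A, a, lam, mu, P⟩ R →
      ∃ R₁ ∈ S, ∃ k : K, k ≠ 0 ∧ R = R₁.rescale 1 k 1 := by
  refine ⟨_, Scene.finite_setOf_sameImages ⟨A, a, lam, mu, P⟩
    (((ambiguitySet_finite hA hl (mu := mu)).inter_of_left
      {v | mu - lam * (v ⬝ᵥ a) ≠ 0}).image fun v =>
      ((mu / (mu - lam * (v ⬝ᵥ a))) • (A + vecMulVec a v), a, lam, mu)) ?_,
      fun R hR hRl hRm h => ?_⟩
  · rintro _ ⟨v, ⟨-, hv⟩, rfl⟩ x y hxy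
    exact independent_add_vecMulVec hA (div_ne_zero hmu hv) v hxy
  · obtain ⟨σ, k, v, hv, hσ, hk, e1, e2, e3⟩ := exists_of_sameImages hA hdet hl h12 h13 hR h
    rw [hRl, hRm] at e3
    -- With the scalars prescribed, `v` determines `σ`, and only the scale `k` stays free.
    have e4 : mu = σ * (mu - lam * (v ⬝ᵥ a)) :=
      mul_right_cancel₀ hl (by linear_combination e3)
    have hne : mu - lam * (v ⬝ᵥ a) ≠ 0 := right_ne_zero_of_mul (e4 ▸ hmu)
    refine ⟨R.rescale 1 k⁻¹ 1, ⟨hR.rescale one_ne_zero one_ne_zero,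
      h.trans (R.sameImages_rescale one_ne_zero (inv_ne_zero hk) one_ne_zero), v, ⟨hv, hne⟩, ?_⟩,
      k, hk, ?_⟩
    · simp only [Scene.rescale, Prod.mk.injEq, hRl, hRm, div_one, one_mul, one_smul, and_true]
      exact ⟨by rw [e2, (div_eq_iff hne).2 e4], by rw [e1, inv_smul_smul₀ hk]⟩
    · have := R.rescale_rescale_inv one_ne_zero (inv_ne_zero hk) one_ne_zero
      rw [inv_inv, inv_one] at this
      exact this.symm

end Scenes

/-! ### The genericity polynomial. -/

/-- The polynomial whose nonvanishing expresses that a quasi-identical pair is general. -/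
def genericityForm {R : Type*} [CommRing R] (A : Matrix (Fin 3) (Fin 3) R) (a : Fin 3 → R)
    (lam mu : R) : R :=
  krylovDet A a * (lam • A - mu • (1 : Matrix (Fin 3) (Fin 3) R)).det *
    (lam • A + mu • (1 : Matrix (Fin 3) (Fin 3) R)).det

theorem map_genericityForm {R S : Type*} [CommRing R] [CommRing S] (f : R →+* S)
    (A : Matrix (Fin 3) (Fin 3) R) (a : Fin 3 → R) (lam mu : R) :
    f (genericityForm A a lam mu) = genericityForm (A.map f) (f ∘ a) (f lam) (f mu) := by
  simp [genericityForm, krylovDet, det_fin_three, mulVec, dotProduct, Fin.sum_univ_three,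
    one_apply, mul_apply]

/-- The genericity form of the general quasi-identical pair. -/
noncomputable def genericityPolynomial : MvPolynomial DataIndex ℝ :=
  genericityForm (Matrix.of fun i j => MvPolynomial.X (Sum.inl (i, j)))
    (fun i => MvPolynomial.X (Sum.inr (Sum.inl i))) (MvPolynomial.X (Sum.inr (Sum.inr 0)))
    (MvPolynomial.X (Sum.inr (Sum.inr 1)))

theorem aeval_genericityPolynomial {K : Type*} [Field K] [Algebra ℝ K]
    (A : Matrix (Fin 3) (Fin 3) K) (a : Fin 3 → K) (lam mu : K) :
    MvPolynomial.aeval (dataPoint A a lam mu) genericityPolynomial =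
      genericityForm A a lam mu := by
  rw [genericityPolynomial, ← AlgHom.coe_toRingHom, map_genericityForm]
  congr 1
  · ext; simp [dataPoint]
  · ext; simp [dataPoint]
  · simp [dataPoint]
  · simp [dataPoint]

theorem genericityPolynomial_ne_zero : genericityPolynomial ≠ 0 := by
  intro h
  -- The cyclic permutation carries the first basis vector through the whole basis, and its
  -- eigenvalues are cube roots of unity, so neither `2` nor `-2` is one.
  have := aeval_genericityPolynomial (K := ℝ) !![0, 0, 1; 1, 0, 0; 0, 1, 0] ![1, 0, 0] 1 2
  rw [h, map_zero] at this
  simp [genericityForm, krylovDet, det_fin_three, dotProduct, Fin.sum_univ_three,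
    one_apply] at this
  norm_num at this

end NRSfM

theorem mainTheorem3 (K : Type*) [RCLike K] :
    ∃ G : MvPolynomial NRSfM.DataIndex ℝ, G ≠ 0 ∧
      ∀ (A : Matrix (Fin 3) (Fin 3) K) (a : Fin 3 → K) (lam mu : K),
        A.det ≠ 0 → lam ≠ 0 → mu ≠ 0 →
        MvPolynomial.aeval (NRSfM.dataPoint A a lam mu) G ≠ 0 →
        -- the system defines a finite variety
        (∀ (A₀ : Matrix (Fin 3) (Fin 3) K) (a₀ : Fin 3 → K)
            (C₀ : Matrix (Fin 3) (Fin 3) K) (c₀ : Fin 3 → K),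
          NRSfM.ProjEq (K := K) (NRSfM.essentialMatrix A a) (NRSfM.essentialMatrix A₀ a₀) →
          NRSfM.ProjEq (K := K)
            (NRSfM.essentialMatrix (NRSfM.totalLinear A lam) (NRSfM.totalTranslation A a lam mu))
            (NRSfM.essentialMatrix C₀ c₀) →
          (NRSfM.systemVariety A₀ a₀ C₀ c₀ lam mu).Finite) ∧
        -- it is one point, which gives the actual deformations, for the actual scale
        (∀ (A₀ : Matrix (Fin 3) (Fin 3) K) (a₀ : Fin 3 → K)
            (C₀ : Matrix (Fin 3) (Fin 3) K) (c₀ : Fin 3 → K),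
          NRSfM.essentialMatrix A₀ a₀ = NRSfM.essentialMatrix A a →
          NRSfM.essentialMatrix C₀ c₀ =
            NRSfM.essentialMatrix (NRSfM.totalLinear A lam)
              (NRSfM.totalTranslation A a lam mu) →
          ∃ p : NRSfM.Unknowns K, NRSfM.systemVariety A₀ a₀ C₀ c₀ lam mu = {p} ∧
            a = p.α • a₀ ∧ A = p.α⁻¹ • (A₀ + Matrix.vecMulVec a₀ p.v₁) ∧
            NRSfM.totalTranslation A a lam mu = p.γ • c₀ ∧
            NRSfM.totalLinear A lam = p.γ⁻¹ • (C₀ + Matrix.vecMulVec c₀ p.v₃)) ∧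
        -- for the actual scale, the whole scene is the only solution
        (∀ (n : ℕ) (P : Fin n → Fin 3 → K) (R : NRSfM.Scene K n),
          R.Valid → R.lam = lam → R.mu = mu →
          NRSfM.Scene.SameImages ⟨A, a, lam, mu, P⟩ R →
          NRSfM.essentialMatrix R.A R.a = NRSfM.essentialMatrix A a →
          NRSfM.essentialMatrix (NRSfM.totalLinear R.A lam)
              (NRSfM.totalTranslation R.A R.a lam mu) =
            NRSfM.essentialMatrix (NRSfM.totalLinear A lam)
              (NRSfM.totalTranslation A a lam mu) →
          R = ⟨A, a, lam, mu, P⟩) ∧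
        -- recovery of the deformations and the structure from the three images
        (∀ (n : ℕ) (P : Fin n → Fin 3 → K),
          NRSfM.DeterminesEssential A a P →
          NRSfM.DeterminesEssential (NRSfM.totalLinear A lam)
            (NRSfM.totalTranslation A a lam mu) P →
          -- the scalars are given: finite up to the global scale
          (∃ S : Set (NRSfM.Scene K n), S.Finite ∧
            ∀ R : NRSfM.Scene K n, R.Valid → R.lam = lam → R.mu = mu →
              NRSfM.Scene.SameImages ⟨A, a, lam, mu, P⟩ R →
              ∃ R₁ ∈ S, ∃ k : K, k ≠ 0 ∧ R = R₁.rescale 1 k 1) ∧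
          -- the scalars are unknown: finite up to the scales of the three positions
          (∃ S : Set (NRSfM.Scene K n), S.Finite ∧
            ∀ R : NRSfM.Scene K n, R.Valid →
              NRSfM.Scene.SameImages ⟨A, a, lam, mu, P⟩ R →
              ∃ R₁ ∈ S, ∃ s k g : K, s ≠ 0 ∧ k ≠ 0 ∧ g ≠ 0 ∧ R = R₁.rescale s k g)) ∧
        -- generic configurations of at least eight points determine the essential matrices
        (∀ n : ℕ, 8 ≤ n → ∃ H : MvPolynomial (Fin n × Fin 3) K, H ≠ 0 ∧
          ∀ P : Fin n → Fin 3 → K, MvPolynomial.eval (fun ij => P ij.1 ij.2) H ≠ 0 →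
            NRSfM.DeterminesEssential A a P ∧
            NRSfM.DeterminesEssential (NRSfM.totalLinear A lam)
              (NRSfM.totalTranslation A a lam mu) P) := by
  refine ⟨NRSfM.genericityPolynomial, NRSfM.genericityPolynomial_ne_zero,
    fun A a lam mu hdet hl hmu hG => ?_⟩
  rw [NRSfM.aeval_genericityPolynomial] at hG
  obtain ⟨hG', h2⟩ := mul_ne_zero_iff.1 hG
  obtain ⟨hA, h1⟩ := mul_ne_zero_iff.1 hG'
  refine ⟨?_, ?_, ?_, ?_, ?_⟩
  · rintro A₀ a₀ C₀ c₀ ⟨s, hs, h12⟩ ⟨s', hs', h13⟩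
    exact NRSfM.systemVariety_finite hA hdet hl hmu hs hs' h12 h13
  · intro A₀ a₀ C₀ c₀ h12 h13
    exact NRSfM.exists_systemVariety_eq_singleton hA hdet hl hmu h1 h2 h12 h13
  · intro n P R hR hRl hRm h h12 h13
    obtain ⟨e1, e2⟩ := NRSfM.eq_of_essentialMatrix_eq hA hdet hl hmu h1 h2 h12 h13
    exact h.eq_of_deformations_eq ⟨hdet, hl, hmu⟩
      (fun x y => NRSfM.eq_zero_of_smul_add_smul_eq_zero hA) e1 e2 hRl hRm
  · intro n P h12 h13
    exact ⟨NRSfM.exists_finite_scenes_of_scalars hA hdet hl hmu h12 h13,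
      NRSfM.exists_finite_scenes hA hdet hl h12 h13⟩
  · intro n hn
    obtain ⟨H, hH, hHP⟩ := NRSfM.exists_forall_determinesEssential hdet
      (NRSfM.ne_zero_of_krylovDet_ne_zero hA) hn
    obtain ⟨H', hH', hHP'⟩ := NRSfM.exists_forall_determinesEssential
      (NRSfM.det_totalLinear_ne_zero hdet hl)
      (NRSfM.totalTranslation_ne_zero (mu := mu) hA hl) hn
    refine ⟨H * H', mul_ne_zero hH hH', fun P hP => ?_⟩
    rw [map_mul] at hP
    exact ⟨hHP P (left_ne_zero_of_mul hP), hHP' P (right_ne_zero_of_mul hP)⟩
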